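/- Let $Q=[0,1]^{\mathbb N}$ be the Hilbert cube with the metric $d(x,y)=\sum_i 2^{-i}|x_i-y_i|$, and call rational balls the open balls whose radius is a positive rational and whose centre has rational coordinates, finitely many of which are non-zero. Let $\mathcal K(Q)$ be the set of all compact subsets of $Q$ (including $\emptyset$). A compact $K\subseteq Q$ is semicomputable relative to an oracle $O\subseteq\mathbb N$ if the set of (codes of) finite lists of rational balls that cover $K$ is c.e. relative to $O$; it is computable relative to $O$ if, moreover, the set of (codes of) rational balls that meet $K$ is c.e. relative to $O$. A pair $(X,A)$ consists of a compact metrizable space $X$ and a compact subset $A\subseteq X$. A copy of $(X,A)$ in $Q$ is a pair $(Y,B)$ with $B\subseteq Y\subseteq Q$ such that some homeomorphism from $X$ onto $Y$ sends $A$ onto $B$. The pair $(X,A)$ has strong computable type if for every oracle $O$ and every copy $(Y,B)$ of $(X,A)$ in $Q$, if $Y$ and $B$ are semicomputable relative to $O$, then $Y$ is computable relative to $O$. The upper Vietoris topology $\tau_{up\mathcal V}$ on $\mathcal K(Q)$ has the numbered basis of the sets $\{K: K\subseteq U\}$, $U$ a finite union of rational balls, and $\mathcal K(Q)\times\mathcal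 K(Q)$ carries the square $\tau_{up\mathcal V}^2$ with the numbered basis of products of two such sets. Sets $\mathcal P_n\subseteq\mathcal K(Q)\times\mathcal K(Q)$, $n\in\mathbb N$, are uniformly $\Pi^0_1$ in $\tau_{up\mathcal V}^2$ if there is a c.e. set $W$ of pairs $(n,i)$ such that for every $n$ the complement of $\mathcal P_n$ is the union of the basic sets with index $i$, $(n,i)\in W$; a set is $\Sigma^0_2$ in $\tau_{up\mathcal V}^2$ if it is a union $\bigcup_n \mathcal F_n\setminus\mathcal G_n$ with $(\mathcal F_n)$ and $(\mathcal G_n)$ uniformly $\Pi^0_1$. A set $\mathcal P\subseteq\mathcal K(Q)\times\mathcal K(Q)$ is an invariant if for every pair $(Y,B)\in\mathcal P$ (so $B\subseteq Y$), every copy of $(Y,B)$ in $Q$ is in $\mathcal P$. A pair $(Y,B)$ in $Q$ is $\mathcal P$-minimal if $(Y,B)\in\mathcal P$ and $(Y',B')\notin\mathcal P$ for all pairs $(Y',B')$ in $Q$ (so $B'\subseteq Y'$) with $Y'\subsetneq Y$ and $B'\subseteq B$. Theorem. For every pair $(X,A)$, the following statements are equivalent: 1. $(X,A)$ has strong computable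 type. 2. There are sets $\mathcal P_n\subseteq\mathcal K(Q)\times\mathcal K(Q)$, $n\in\mathbb N$, uniformly $\Pi^0_1$ in $\tau_{up\mathcal V}^2$, whose union $\bigcup_{n\in\mathbb N}\mathcal P_n$ is a $\Sigma^0_2$ invariant, such that every copy of $(X,A)$ in $Q$ is $\mathcal P_n$-minimal for some $n$. -/

import Mathlib

open TopologicalSpace

namespace SCT

/-! ### Relative computable enumerability -/

open Classical in
/-- The characteristic function of an oracle `O ⊆ ℕ`, as a (total) function that may be queried. -/
noncomputable def oracleFun (O : Set ℕ) : ℕ →. ℕ :=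
  fun n => Part.some (if n ∈ O then 1 else 0)

/-- The set `{a | p a}` is computably enumerable relative to the oracle `O`: it is the domain of a
partial function which is recursive in `O`. (For no oracle this is Mathlib's `REPred`.) -/
def REPredIn {α : Type*} [Primcodable α] (O : Set ℕ) (p : α → Prop) : Prop :=
  RecursiveIn {oracleFun O} fun a => Part.assert (p a) fun _ => Part.some ()

/-! ### The Hilbert cube and its rational balls -/

/-- The Hilbert cube `[0,1]^ℕ`, with its product topology (which `distQ` below metrizes). -/
abbrev HilbertCube : Type := ℕ → unitInterval

/-- The metric `d(x,y) = ∑ᵢ 2⁻ⁱ |xᵢ - yᵢ|` of the Hilbert cube. -/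
noncomputable def distQ (x y : HilbertCube) : ℝ :=
  ∑' i : ℕ, (1 / 2 : ℝ) ^ i * |(x i : ℝ) - (y i : ℝ)|

/-- The rational number of `[0,1]` coded by `(a, b)`, namely `min (a / (b + 1)) 1`. -/
noncomputable def ratCoord (c : ℕ × ℕ) : unitInterval :=
  ⟨min ((c.1 : ℝ) / ((c.2 : ℝ) + 1)) 1,
    le_min (by positivity) zero_le_one, min_le_right _ _⟩

/-- The point of the Hilbert cube coded by a list: its first coordinates are the listed rational
numbers, all the others are `0`. Every point with rational coordinates, finitely many of which are
non-zero, has a code. -/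
noncomputable def ratPoint (l : List (ℕ × ℕ)) : HilbertCube :=
  fun i => (l.map ratCoord).getD i 0

/-- Codes of rational balls: a code of the centre, and a code of the radius. -/
abbrev BallCode : Type := List (ℕ × ℕ) × (ℕ × ℕ)

/-- The rational ball with centre `ratPoint l` and radius `(r + 1) / (s + 1)`,
where the code is `(l, (r, s))`. -/
def ratBall (b : BallCode) : Set HilbertCube :=
  {x | distQ (ratPoint b.1) x < ((b.2.1 : ℝ) + 1) / ((b.2.2 : ℝ) + 1)}

/-- The finite union of rational balls coded by a list. -/
def ratUnion (l : List BallCode) : Set HilbertCube :=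
  {x | ∃ b ∈ l, x ∈ ratBall b}

/-! ### Semicomputable and computable compact sets, relative to an oracle -/

/-- The compact set `K` is semicomputable (effectively compact) relative to `O`: the set of finite
families of rational balls that cover `K` is c.e. relative to `O`. -/
def SemicomputableIn (O : Set ℕ) (K : Compacts HilbertCube) : Prop :=
  REPredIn O fun l : List BallCode => (K : Set HilbertCube) ⊆ ratUnion l

/-- The set `K` is computably overt relative to `O`: the set of rational balls that meet `K` is
c.e. relative to `O`. -/
def OvertIn (O : Set ℕ) (K : Compacts HilbertCube) : Prop :=
  REPredIn O fun b : BallCode => ((K : Set HilbertCube) ∩ ratBall b).Nonempty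

/-- The compact set `K` is computable relative to `O`. -/
def ComputableCompactIn (O : Set ℕ) (K : Compacts HilbertCube) : Prop :=
  SemicomputableIn O K ∧ OvertIn O K

/-! ### Pairs, copies and strong computable type -/

/-- `(Y, B)` is a copy in the Hilbert cube of the pair `(X, A)`: some homeomorphism from `X` onto
`Y` sends `A` onto `B`. -/
def IsCopy {X : Type*} [TopologicalSpace X] (A : Set X)
    (q : Compacts HilbertCube × Compacts HilbertCube) : Prop :=
  ∃ h : X ≃ₜ (q.1 : Set HilbertCube),
    (fun x => (h x : HilbertCube)) '' A = (q.2 : Set HilbertCube)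

/-- The pair `(X, A)` has strong computable type: for every oracle `O` and every copy `(Y, B)` in
the Hilbert cube, if `Y` and `B` are semicomputable relative to `O`, then `Y` is computable
relative to `O`. -/
def StrongComputableType {X : Type*} [TopologicalSpace X] (A : Set X) : Prop :=
  ∀ (O : Set ℕ) (q : Compacts HilbertCube × Compacts HilbertCube), IsCopy A q →
    SemicomputableIn O q.1 → SemicomputableIn O q.2 → ComputableCompactIn O q.1

/-! ### Effective descriptive complexity in a space with a numbered basis -/

/-- The sets `P n` are uniformly `Π⁰₁` with respect to the numbered basis `basis`: their complements
are unions of basic sets whose indices are c.e., uniformly in `n`. -/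
def UniformlyPi01 {Z ι : Type*} [Primcodable ι] (basis : ι → Set Z) (P : ℕ → Set Z) : Prop :=
  ∃ W : ℕ × ι → Prop, REPred W ∧ ∀ n, (P n)ᶜ = ⋃ i ∈ {i | W (n, i)}, basis i

/-- The set `S` is `Σ⁰₂` with respect to the numbered basis `basis`: it is a union of differences
of uniformly `Π⁰₁` sets. -/
def IsSigma02 {Z ι : Type*} [Primcodable ι] (basis : ι → Set Z) (S : Set Z) : Prop :=
  ∃ F G : ℕ → Set Z, UniformlyPi01 basis F ∧ UniformlyPi01 basis G ∧ S = ⋃ n, F n \ G n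

/-- The numbered basis of the square of the upper Vietoris topology on the hyperspace of compact
subsets of the Hilbert cube. The basic sets of the upper Vietoris topology are `{K | K ⊆ U}`, for
`U` a finite union of rational balls, and those of its square are the products of two such sets. -/
def upVietorisSqBasis (i : List BallCode × List BallCode) :
    Set (Compacts HilbertCube × Compacts HilbertCube) :=
  {q | (q.1 : Set HilbertCube) ⊆ ratUnion i.1} ∩ {q | (q.2 : Set HilbertCube) ⊆ ratUnion i.2}

/-! ### Invariants and minimality -/

/-- `(X, A)` is a pair, that is, `A ⊆ X`. -/
def IsPair (p : Compacts HilbertCube × Compacts HilbertCube) : Prop :=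
  (p.2 : Set HilbertCube) ⊆ p.1

/-- A property of pairs is a topological invariant if it contains every copy (in the Hilbert cube)
of every pair that it contains. -/
def IsInvariant (P : Set (Compacts HilbertCube × Compacts HilbertCube)) : Prop :=
  ∀ p ∈ P, IsPair p → ∀ q : Compacts HilbertCube × Compacts HilbertCube,
    IsCopy ((↑) ⁻¹' (p.2 : Set HilbertCube) : Set (p.1 : Set HilbertCube)) q → q ∈ P

/-- `(Y, B)` is a proper subpair of `(X, A)`: `Y ⊊ X` and `B ⊆ A` (and `B ⊆ Y`). -/
def IsProperSubpair (q p : Compacts HilbertCube × Compacts HilbertCube) : Prop :=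
  IsPair q ∧ (q.1 : Set HilbertCube) ⊂ p.1 ∧ (q.2 : Set HilbertCube) ⊆ p.2

/-- `p` is `P`-minimal: it has the property `P` and none of its proper subpairs has. -/
def IsMinimalFor (P : Set (Compacts HilbertCube × Compacts HilbertCube))
    (p : Compacts HilbertCube × Compacts HilbertCube) : Prop :=
  p ∈ P ∧ ∀ q, IsProperSubpair q p → q ∉ P

end SCT

/-! If `(Y, B)` is minimal for an effectively closed set `P n`, a rational ball `b` meets `Y`
exactly when removing `b` from both components leaves `P n`: removal either changes nothing or
produces a proper subpair. Leaving `P n` means entering an enumerated basic set, and `K \ b ⊆ U`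
amounts to `K ⊆ b ∪ U`, so covers of `Y` and `B` suffice to enumerate the balls that meet `Y`
(`UniformlyPi01.computableCompactIn`).

Conversely, take for `P` a numbering of all effectively closed sets. Their union is the whole space,
hence trivially invariant. Given a copy `q`, `exists_generic_oracle` yields a generic oracle `O`
that enumerates the basic neighbourhoods of `q`. Relative to `O` both components are semicomputable,
so the first is overt; by the use principle, a monotone c.e. relation `R (b, τ)` on balls and
strings witnesses this. By genericity, a prefix `σ` of `O` forces soundness: no admissible extension
of `σ` makes `R` accept a ball that misses `q.1`.

Let `P n` consist of the pairs outside every basic set that refines all sets declared by some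
extension `τ` of `σ` and whose first component is disjoint from a ball accepted by `R` at `τ`.
Soundness puts `q` in `P n`. A proper subpair misses some ball that meets `q.1`; it lies in all
neighbourhoods of `q`, so a true prefix of `O` expels it
(`StrongComputableType.exists_isMinimalFor`). -/

namespace SCT

open Encodable Denumerable
open Nat.Partrec (Code)

/-! ### Computably enumerable predicates -/

section RE

variable {α β : Type*} [Primcodable α] [Primcodable β]

theorem rePred_iff_exists_code {p : α → Prop} :
    REPred p ↔ ∃ c : Code, ∀ a, p a ↔ (c.eval (encode a)).Dom := by
  constructor
  · intro hp
    obtain ⟨c, hc⟩ := Code.exists_code.1 hp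
    refine ⟨c, fun a => ?_⟩
    rw [hc]
    simp [Part.assert]
  · rintro ⟨c, hc⟩
    have h : Partrec fun a : α => c.eval (encode a) :=
      Code.eval_part.comp (Computable.const c) Computable.encode
    exact h.dom_re.of_eq fun a => (hc a).symm

theorem rePred_of_exists_bool {r : α → ℕ → Bool} (hr : Primrec₂ r) :
    REPred fun a => ∃ k, r a k = true := by
  have h : Partrec fun a => Nat.rfind fun k => (Part.some (r a k) : Part Bool) :=
    Partrec.rfind hr.to_comp.partrec₂
  refine h.dom_re.of_eq fun a => Nat.rfind_dom.trans ?_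
  exact ⟨fun ⟨k, hk, _⟩ => ⟨k, (Part.mem_some_iff.1 hk).symm⟩,
    fun ⟨k, hk⟩ => ⟨k, Part.mem_some_iff.2 hk.symm, fun _ => trivial⟩⟩

/-- Halting within `k` steps is primitive recursive in `k`. This normal form reduces closure
properties to constructions on primitive recursive functions. -/
theorem _root_.REPred.exists_bool {p : α → Prop} (hp : REPred p) :
    ∃ r : α → ℕ → Bool, Primrec₂ r ∧ ∀ a, p a ↔ ∃ k, r a k = true := by
  obtain ⟨c, hc⟩ := rePred_iff_exists_code.1 hp
  refine ⟨fun a k => (Code.evaln k c (encode a)).isSome, ?_, fun a => ?_⟩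
  · exact Primrec.option_isSome.comp (Code.primrec_evaln.comp
      (Primrec.pair (Primrec.pair Primrec.snd (Primrec.const c))
        (Primrec.encode.comp Primrec.fst)))
  · rw [hc, Part.dom_iff_mem]
    simp only [Code.evaln_complete, Option.isSome_iff_exists]
    exact exists_comm

theorem _root_.PrimrecPred.rePred {p : α → Prop} (hp : PrimrecPred p) : REPred p := by
  obtain ⟨_, h⟩ := hp
  refine (rePred_of_exists_bool (r := fun a _ => decide (p a)) (h.comp Primrec.fst)).of_eq
    fun a => ?_
  simp

theorem _root_.REPred.comp {p : β → Prop} (hp : REPred p) {f : α → β} (hf : Computable f) :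
    REPred fun a => p (f a) :=
  Partrec.comp hp hf

theorem _root_.REPred.and {p q : α → Prop} (hp : REPred p) (hq : REPred q) :
    REPred fun a => p a ∧ q a := by
  have h : Partrec fun a => (Part.assert (p a) fun _ => Part.some ()).bind
      fun _ => Part.assert (q a) fun _ => Part.some () :=
    Partrec.bind hp (Partrec.comp hq Computable.fst).to₂
  refine h.dom_re.of_eq fun a => ?_
  simp [Part.assert]

theorem _root_.REPred.exists {p : α × β → Prop} (hp : REPred p) :
    REPred fun a => ∃ b, p (a, b) := by
  obtain ⟨r, hr, h⟩ := hp.exists_bool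
  -- One search variable codes both the witness and the stage; numbers that decode to no witness are
  -- rejected.
  let s : α → ℕ → Bool := fun a n =>
    Option.casesOn (decode (α := β) n.unpair.1) false fun b => r (a, b) n.unpair.2
  have hs : Primrec₂ s := by
    refine Primrec.option_casesOn
      (Primrec.decode.comp (Primrec.fst.comp (Primrec.unpair.comp Primrec.snd)))
      (Primrec.const false) ?_
    exact hr.comp
      (Primrec.pair (Primrec.fst.comp Primrec.fst) Primrec.snd)
      (Primrec.snd.comp (Primrec.unpair.comp (Primrec.snd.comp Primrec.fst)))
  refine (rePred_of_exists_bool hs).of_eq fun a => ?_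
  simp only [h]
  constructor
  · rintro ⟨n, hn⟩
    simp only [s] at hn
    cases hb : decode (α := β) n.unpair.1 with
    | none => simp [hb] at hn
    | some b => exact ⟨b, n.unpair.2, by simpa [hb] using hn⟩
  · rintro ⟨b, k, hk⟩
    exact ⟨Nat.pair (encode b) k, by simpa [s] using hk⟩

end RE

/-! ### Finite prefixes of oracles and the use principle -/

section Oracle

open Classical in
/-- The string of the first `m` values of the characteristic function of `O`. -/
noncomputable def oraclePrefix (O : Set ℕ) (m : ℕ) : List Bool :=
  (List.range m).map fun n => decide (n ∈ O)

@[simp] theorem length_oraclePrefix (O : Set ℕ) (m : ℕ) : (oraclePrefix O m).length = m := by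
  simp [oraclePrefix]

open Classical in
theorem getElem?_oraclePrefix (O : Set ℕ) (m n : ℕ) :
    (oraclePrefix O m)[n]? = if n < m then some (decide (n ∈ O)) else none := by
  by_cases h : n < m <;> simp [oraclePrefix, h]

open Classical in
theorem oraclePrefix_succ (O : Set ℕ) (m : ℕ) :
    oraclePrefix O (m + 1) = oraclePrefix O m ++ [decide (m ∈ O)] := by
  simp [oraclePrefix, List.range_succ]

theorem oraclePrefix_prefix (O : Set ℕ) {m n : ℕ} (h : m ≤ n) :
    oraclePrefix O m <+: oraclePrefix O n := by
  induction n, h using Nat.le_induction with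
  | base => exact List.prefix_rfl
  | succ n _ ih => exact ih.trans (by rw [oraclePrefix_succ]; exact List.prefix_append _ _)

/-- `F` approximates `f` monotonically, using finite prefixes of the oracle `O`. -/
structure Approximates (O : Set ℕ) (F : ℕ × List Bool →. ℕ) (f : ℕ →. ℕ) : Prop where
  partrec : Partrec F
  mono : ∀ {n σ τ y}, σ <+: τ → y ∈ F (n, σ) → y ∈ F (n, τ)
  mem_iff : ∀ {n y}, y ∈ f n ↔ ∃ m, y ∈ F (n, oraclePrefix O m)

variable {O : Set ℕ} {F G : ℕ × List Bool →. ℕ} {f g : ℕ →. ℕ}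

theorem Approximates.mono_le (hF : Approximates O F f) {n y m m' : ℕ} (h : m ≤ m')
    (hy : y ∈ F (n, oraclePrefix O m)) : y ∈ F (n, oraclePrefix O m') :=
  hF.mono (oraclePrefix_prefix O h) hy

theorem approximates_of_partrec (hf : Partrec f) :
    Approximates O (fun p => f p.1) f :=
  ⟨hf.comp Computable.fst, fun _ h => h, by simp⟩

/-- A query beyond the end of the string is undefined rather than answered by a default; this gives
monotonicity. -/
theorem approximates_oracle :
    Approximates O (fun p => ((p.2[p.1]?).map fun b => cond b 1 0 : Option ℕ)) (oracleFun O) where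
  partrec := Computable.ofOption <| Computable.option_map
    (Computable.list_getElem?.comp Computable.snd Computable.fst)
    (Computable.cond Computable.snd (Computable.const 1) (Computable.const 0))
  mono := by
    rintro n σ τ y ⟨ρ, rfl⟩ h
    simp only [Part.mem_ofOption, Option.mem_def, Option.map_eq_some_iff] at h ⊢
    obtain ⟨b, hb, rfl⟩ := h
    refine ⟨b, ?_, rfl⟩
    rw [List.getElem?_append_left (List.getElem?_eq_some_iff.1 hb).1, hb]
  mem_iff := by
    classical
    intro n y
    simp only [oracleFun, Part.mem_some_iff, Part.mem_ofOption, Option.mem_def,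
      Option.map_eq_some_iff, getElem?_oraclePrefix]
    constructor
    · rintro rfl
      refine ⟨n + 1, decide (n ∈ O), by simp, ?_⟩
      by_cases h : n ∈ O <;> simp [h]
    · rintro ⟨m, b, hb, rfl⟩
      by_cases hm : n < m
      · by_cases h : n ∈ O <;> simp_all
      · simp [hm] at hb

theorem Approximates.pair (hF : Approximates O F f) (hG : Approximates O G g) :
    Approximates O (fun p => Nat.pair <$> F p <*> G p) fun n => Nat.pair <$> f n <*> g n where
  partrec := by
    refine (hF.partrec.bind (Partrec.map (hG.partrec.comp Computable.fst).to₂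
      (g := fun q b => Nat.pair q.2 b) ?_).to₂).of_eq fun p => ?_
    · exact Primrec₂.natPair.to_comp.comp (Computable.snd.comp Computable.fst) Computable.snd
    · simp [Seq.seq, Part.bind_map]
  mono := by
    intro n σ τ y h hy
    simp only [Seq.seq, Part.map_eq_map, Part.bind_map, Part.mem_bind_iff, Part.mem_map_iff] at hy ⊢
    obtain ⟨a, ha, b, hb, rfl⟩ := hy
    exact ⟨a, hF.mono h ha, b, hG.mono h hb, rfl⟩
  mem_iff := by
    intro n y
    simp only [Seq.seq, Part.map_eq_map, Part.bind_map, Part.mem_bind_iff, Part.mem_map_iff,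
      hF.mem_iff, hG.mem_iff]
    constructor
    · rintro ⟨a, ⟨m, ha⟩, b, ⟨m', hb⟩, rfl⟩
      exact ⟨max m m', a, hF.mono_le (le_max_left _ _) ha, b, hG.mono_le (le_max_right _ _) hb,
        rfl⟩
    · rintro ⟨m, a, ha, b, hb, rfl⟩
      exact ⟨a, ⟨m, ha⟩, b, ⟨m, hb⟩, rfl⟩

theorem Approximates.comp (hF : Approximates O F f) (hG : Approximates O G g) :
    Approximates O (fun p => G p >>= fun y => F (y, p.2)) fun n => g n >>= f where
  partrec := hG.partrec.bind
    (hF.partrec.comp (Computable.pair Computable.snd (Computable.snd.comp Computable.fst))).to₂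
  mono := by
    intro n σ τ y h hy
    simp only [Part.bind_eq_bind, Part.mem_bind_iff] at hy ⊢
    obtain ⟨a, ha, hb⟩ := hy
    exact ⟨a, hG.mono h ha, hF.mono h hb⟩
  mem_iff := by
    intro n y
    have e : y ∈ (g n >>= f) ↔ ∃ a ∈ g n, y ∈ f a := Part.mem_bind_iff
    simp only [e, Part.bind_eq_bind, Part.mem_bind_iff, hF.mem_iff, hG.mem_iff]
    constructor
    · rintro ⟨a, ⟨m, ha⟩, m', hb⟩
      exact ⟨max m m', a, hG.mono_le (le_max_left _ _) ha, hF.mono_le (le_max_right _ _) hb⟩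
    · rintro ⟨m, a, ha, hb⟩
      exact ⟨a, ⟨m, ha⟩, m, hb⟩

theorem Approximates.prec (hF : Approximates O F f) (hG : Approximates O G g) :
    Approximates O
      (fun p => (p.1.unpair.2).rec (F (p.1.unpair.1, p.2)) fun y IH =>
        IH.bind fun i => G (Nat.pair p.1.unpair.1 (Nat.pair y i), p.2))
      fun p => (p.unpair.2).rec (f p.unpair.1) fun y IH =>
        IH.bind fun i => g (Nat.pair p.unpair.1 (Nat.pair y i)) where
  partrec := by
    have hun : Computable fun p : ℕ × List Bool => p.1.unpair :=
      Computable.unpair.comp Computable.fst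
    refine Partrec.nat_rec (Computable.snd.comp hun)
      (hF.partrec.comp (Computable.pair (Computable.fst.comp hun) Computable.snd))
      (h := fun p q => G (Nat.pair p.1.unpair.1 (Nat.pair q.1 q.2), p.2)) ?_
    refine hG.partrec.comp (Computable.pair ?_ (Computable.snd.comp Computable.fst))
    exact Primrec₂.natPair.to_comp.comp (Computable.fst.comp (hun.comp Computable.fst))
      (Primrec₂.natPair.to_comp.comp (Computable.fst.comp Computable.snd)
        (Computable.snd.comp Computable.snd))
  mono := by
    intro n σ τ y h
    simp only
    induction n.unpair.2 generalizing y with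
    | zero => exact fun hy => hF.mono h hy
    | succ k ih =>
      intro hy
      simp only [Part.mem_bind_iff] at hy ⊢
      obtain ⟨i, hi, hy⟩ := hy
      exact ⟨i, ih hi, hG.mono h hy⟩
  mem_iff := by
    intro n y
    simp only
    -- Monotonicity at each stage of the recursion, so that the uses of the earlier stages and of
    -- the last call fit in one common prefix.
    have hmono : ∀ (k : ℕ) {y m m' : ℕ}, m ≤ m' →
        y ∈ (Nat.rec (F (n.unpair.1, oraclePrefix O m)) (fun y IH =>
          IH.bind fun i => G (Nat.pair n.unpair.1 (Nat.pair y i), oraclePrefix O m)) k : Part ℕ) →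
        y ∈ (Nat.rec (F (n.unpair.1, oraclePrefix O m')) (fun y IH =>
          IH.bind fun i =>
            G (Nat.pair n.unpair.1 (Nat.pair y i), oraclePrefix O m')) k : Part ℕ) := by
      intro k
      induction k with
      | zero => exact fun h hy => hF.mono_le h hy
      | succ k ih =>
        intro y m m' h hy
        simp only [Part.mem_bind_iff] at hy ⊢
        obtain ⟨i, hi, hy⟩ := hy
        exact ⟨i, ih h hi, hG.mono_le h hy⟩
    induction n.unpair.2 generalizing y with
    | zero => exact hF.mem_iff
    | succ k ih =>
      simp only [Part.mem_bind_iff, ih, hG.mem_iff]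
      constructor
      · rintro ⟨i, ⟨m, hi⟩, m', hy⟩
        exact ⟨max m m', i, hmono k (le_max_left _ _) hi, hG.mono_le (le_max_right _ _) hy⟩
      · rintro ⟨m, i, hi, hy⟩
        exact ⟨i, ⟨m, hi⟩, m, hy⟩

theorem mem_rfind_eq_zero {f : ℕ → Part ℕ} {y : ℕ} :
    y ∈ Nat.rfind (fun n => (fun m => decide (m = 0)) <$> f n) ↔
      0 ∈ f y ∧ ∀ k < y, ∃ b ∈ f k, b ≠ 0 := by
  refine Nat.mem_rfind.trans (and_congr ?_ (forall₂_congr fun k _ => ?_))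
  · refine (Part.mem_map_iff _).trans ?_
    simp
  · refine (Part.mem_map_iff _).trans ?_
    simp

theorem Approximates.rfind (hF : Approximates O F f) :
    Approximates O
      (fun p => Nat.rfind fun n => (fun m => decide (m = 0)) <$> F (Nat.pair p.1 n, p.2))
      fun a => Nat.rfind fun n => (fun m => decide (m = 0)) <$> f (Nat.pair a n) where
  partrec := by
    refine Partrec.rfind (Partrec.map (g := fun _ m => decide (m = 0)) (hF.partrec.comp
      (Computable.pair (Primrec₂.natPair.to_comp.comp (Computable.fst.comp Computable.fst)
        Computable.snd) (Computable.snd.comp Computable.fst))) ?_)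
    exact (Primrec.eq.decide.comp Primrec.snd (Primrec.const 0)).to_comp
  mono := by
    intro n σ τ y h hy
    rw [mem_rfind_eq_zero] at hy ⊢
    exact ⟨hF.mono h hy.1, fun k hk => (hy.2 k hk).imp fun b hb => ⟨hF.mono h hb.1, hb.2⟩⟩
  mem_iff := by
    intro n y
    simp only [mem_rfind_eq_zero, hF.mem_iff]
    constructor
    · rintro ⟨⟨m, h0⟩, hlt⟩
      -- Only finitely many values below `y` are inspected, so the supremum of their uses gives one
      -- prefix that serves them all.
      choose! b hb hb0 using hlt
      choose! M hM using hb
      refine ⟨max m ((Finset.range y).sup M), hF.mono_le (le_max_left _ _) h0,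
        fun k hk => ⟨b k, hF.mono_le ?_ (hM k hk), hb0 k hk⟩⟩
      exact le_max_of_le_right (Finset.le_sup (f := M) (Finset.mem_range.2 hk))
    · rintro ⟨m, h0, hlt⟩
      refine ⟨⟨m, h0⟩, fun k hk => ?_⟩
      obtain ⟨b, hb, hb0⟩ := hlt k hk
      exact ⟨b, ⟨m, hb⟩, hb0⟩

/-- The use principle. -/
theorem exists_approximates (hf : Nat.RecursiveIn {oracleFun O} f) :
    ∃ F, Approximates O F f := by
  induction hf with
  | zero => exact ⟨_, approximates_of_partrec (Partrec.nat_iff.2 Nat.Partrec.zero)⟩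
  | succ => exact ⟨_, approximates_of_partrec (Partrec.nat_iff.2 Nat.Partrec.succ)⟩
  | left => exact ⟨_, approximates_of_partrec (Partrec.nat_iff.2 Nat.Partrec.left)⟩
  | right => exact ⟨_, approximates_of_partrec (Partrec.nat_iff.2 Nat.Partrec.right)⟩
  | oracle g hg => rw [Set.mem_singleton_iff.1 hg]; exact ⟨_, approximates_oracle⟩
  | pair _ _ ihf ihg =>
    obtain ⟨F, hF⟩ := ihf
    obtain ⟨G, hG⟩ := ihg
    exact ⟨_, hF.pair hG⟩
  | comp _ _ ihf ihg =>
    obtain ⟨F, hF⟩ := ihf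
    obtain ⟨G, hG⟩ := ihg
    exact ⟨_, hF.comp hG⟩
  | prec _ _ ihf ihg =>
    obtain ⟨F, hF⟩ := ihf
    obtain ⟨G, hG⟩ := ihg
    exact ⟨_, hF.prec hG⟩
  | rfind _ ihf =>
    obtain ⟨F, hF⟩ := ihf
    exact ⟨_, hF.rfind⟩

end Oracle

/-! ### Relative enumerability as unrelativized enumerability on oracle prefixes -/

section Relative

variable {α : Type*} [Primcodable α] {O : Set ℕ}

theorem REPredIn.exists_rePred {p : α → Prop} (hp : REPredIn O p) :
    ∃ R : α × List Bool → Prop, REPred R ∧ (∀ a σ τ, σ <+: τ → R (a, σ) → R (a, τ)) ∧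
      ∀ a, p a ↔ ∃ m, R (a, oraclePrefix O m) := by
  obtain ⟨F, hF⟩ := exists_approximates hp
  refine ⟨fun x => (F (encode x.1, x.2)).Dom, ?_, fun a σ τ h hR => ?_, fun a => ?_⟩
  · exact (hF.partrec.comp
      (Computable.pair (Computable.encode.comp Computable.fst) Computable.snd)).dom_re
  · obtain ⟨y, hy⟩ := Part.dom_iff_mem.1 hR
    exact Part.dom_iff_mem.2 ⟨y, hF.mono h hy⟩
  · have : p a ↔ ∃ y, y ∈ ((decode (α := α) (encode a) : Part α).bind fun a =>
        (Part.assert (p a) fun _ => Part.some ()).map encode) := by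
      simp [Part.mem_assert_iff]
    rw [this]
    simp only [hF.mem_iff, Part.dom_iff_mem]
    exact exists_comm

open Classical in
theorem recursiveIn_oraclePrefix :
    Nat.RecursiveIn {oracleFun O} fun m => Part.some (encode (oraclePrefix O m)) := by
  -- The argument pairs the data of the recursion (parameter, index, previous string) with the
  -- oracle's answer at that index, which is appended.
  let step : ℕ → ℕ := fun x =>
    encode (((decode (α := List Bool) x.unpair.1.unpair.2.unpair.2).getD []) ++ [decide (x.unpair.2 = 1)])
  have hstep : Nat.Primrec step := by
    refine Primrec.nat_iff.1 (Primrec.encode.comp (Primrec.list_concat.comp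
      (Primrec.option_getD.comp (Primrec.decode.comp ?_) (Primrec.const [])) ?_))
    · exact Primrec.snd.comp (Primrec.unpair.comp (Primrec.snd.comp (Primrec.unpair.comp
        (Primrec.fst.comp Primrec.unpair))))
    · exact Primrec.eq.decide.comp (Primrec.snd.comp Primrec.unpair) (Primrec.const 1)
  have hid : Nat.RecursiveIn {oracleFun O} (fun n : ℕ => Part.some n) :=
    Nat.Primrec.recursiveIn Nat.Primrec.id
  have hor : Nat.RecursiveIn {oracleFun O} fun x => Part.some x.unpair.2.unpair.1 >>= oracleFun O :=
    .comp (.oracle _ rfl) (Nat.Primrec.recursiveIn (Primrec.nat_iff.1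
      (Primrec.fst.comp (Primrec.unpair.comp (Primrec.snd.comp Primrec.unpair)))))
  have hrec := Nat.RecursiveIn.prec
    (Nat.Primrec.recursiveIn (O := {oracleFun O}) (Nat.Primrec.const (encode ([] : List Bool))))
    (.comp (Nat.Primrec.recursiveIn hstep) (.pair hid hor))
  refine (Nat.RecursiveIn.comp hrec (Nat.Primrec.recursiveIn (O := {oracleFun O})
    (Primrec.nat_iff.1 (Primrec₂.natPair.comp (Primrec.const 0) Primrec.id)))).of_eq fun m => ?_
  refine (Part.bind_some _ _).trans ?_
  simp only [id, Nat.unpair_pair]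
  induction m with
  | zero => simp [oraclePrefix]
  | succ m ih =>
    refine (congrArg (fun s => Part.bind s _) ih).trans ((Part.bind_some _ _).trans ?_)
    have e : (Part.some m >>= oracleFun O) = Part.some (if m ∈ O then 1 else 0) :=
      Part.bind_some _ _
    by_cases h : m ∈ O <;> simp [step, Seq.seq, e, oraclePrefix_succ, h]

theorem rePredIn_of_rePred {R : α × List Bool → Prop} (hR : REPred R) :
    REPredIn O fun a => ∃ m, R (a, oraclePrefix O m) := by
  obtain ⟨r, hr, h⟩ := hR.exists_bool
  -- The search looks for a zero, so `0` signals success; the searched number codes a prefix length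
  -- and a stage. Codes outside `α` give the constant `1` and the search diverges.
  let t : ℕ → ℕ := fun x =>
    Option.casesOn (decode (α := α) x.unpair.1.unpair.1) 1 fun a =>
      cond (r (a, (decode (α := List Bool) x.unpair.2).getD []) x.unpair.1.unpair.2.unpair.2) 0 1
  have ht : Nat.Primrec t := by
    refine Primrec.nat_iff.1 (Primrec.option_casesOn
      (Primrec.decode.comp (Primrec.fst.comp (Primrec.unpair.comp (Primrec.fst.comp
        Primrec.unpair)))) (Primrec.const 1) ?_)
    refine Primrec.cond (hr.comp (Primrec.pair Primrec.snd (Primrec.option_getD.comp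
      (Primrec.decode.comp (Primrec.snd.comp (Primrec.unpair.comp Primrec.fst)))
      (Primrec.const []))) ?_) (Primrec.const 0)
      (Primrec.const 1)
    exact Primrec.snd.comp (Primrec.unpair.comp (Primrec.snd.comp (Primrec.unpair.comp
      (Primrec.fst.comp (Primrec.unpair.comp Primrec.fst)))))
  have hid : Nat.RecursiveIn {oracleFun O} (fun n : ℕ => Part.some n) :=
    Nat.Primrec.recursiveIn Nat.Primrec.id
  have hpre : Nat.RecursiveIn {oracleFun O}
      (fun x : ℕ => Part.some x.unpair.2.unpair.1 >>= fun m =>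
        Part.some (encode (oraclePrefix O m))) :=
    .comp recursiveIn_oraclePrefix (Nat.Primrec.recursiveIn (Primrec.nat_iff.1
      (Primrec.fst.comp (Primrec.unpair.comp (Primrec.snd.comp Primrec.unpair)))))
  have hfind := Nat.RecursiveIn.comp
    (Nat.Primrec.recursiveIn (O := {oracleFun O}) (Nat.Primrec.const 0))
    (Nat.RecursiveIn.rfind (.comp (Nat.Primrec.recursiveIn ht) (.pair hid hpre)))
  have key : ∀ n z y, (y ∈ Nat.pair <$> Part.some (Nat.pair n z) <*>
      (Part.some (Nat.pair n z).unpair.2.unpair.1 >>= fun m =>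
        Part.some (encode (oraclePrefix O m))) >>= fun x => ((some (t x) : Option ℕ) : Part ℕ)) ↔
      y = t (Nat.pair (Nat.pair n z) (encode (oraclePrefix O z.unpair.1))) := by
    intro n z y
    simp [Seq.seq]
  refine hfind.of_eq fun n => Part.ext fun y => Part.mem_bind_iff.trans ?_
  simp only [mem_rfind_eq_zero, key]
  cases hn : decode (α := α) n with
  | none => simp [t, hn]
  | some a =>
    have ht0 : ∀ z, 0 = t (Nat.pair (Nat.pair n z) (encode (oraclePrefix O z.unpair.1))) ↔
        r (a, oraclePrefix O z.unpair.1) z.unpair.2 = true := by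
      intro z
      cases hr : r (a, oraclePrefix O z.unpair.1) z.unpair.2 <;> simp [t, hn, hr]
    have hex : (∃ m, R (a, oraclePrefix O m)) ↔
        ∃ z : ℕ, r (a, oraclePrefix O z.unpair.1) z.unpair.2 = true := by
      simp only [h]
      exact ⟨fun ⟨m, k, hk⟩ => ⟨Nat.pair m k, by simpa using hk⟩, fun ⟨z, hz⟩ => ⟨_, _, hz⟩⟩
    have hR : (y ∈ Part.bind (some a : Option α) fun a =>
        (Part.assert (∃ m, R (a, oraclePrefix O m)) fun _ => Part.some ()).map encode) ↔
        (∃ m, R (a, oraclePrefix O m)) ∧ y = 0 := by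
      have hu : ∀ u : Unit, encode u = 0 := fun _ => rfl
      simp [Part.mem_assert_iff, hu, eq_comm]
    rw [hR, hex]
    simp only [exists_eq_left, ne_eq, eq_comm (b := 0), ht0]
    constructor
    · rintro ⟨z, ⟨hz, -⟩, hy⟩
      exact ⟨⟨z, hz⟩, (by simpa using hy : y = 0).symm⟩
    · rintro ⟨hz, rfl⟩
      classical
      exact ⟨Nat.find hz, ⟨Nat.find_spec hz, fun k hk => Nat.find_min hz hk⟩, by simp⟩

end Relative

/-! ### Generic enumerations -/

section Generic

/-- A string is admissible for `S` if it is compatible with an oracle `O` such that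
`n ∈ S ↔ ∃ k, Nat.pair n k ∈ O`. -/
def Admissible (S : Set ℕ) (σ : List Bool) : Prop :=
  ∀ n : ℕ, σ[n]? = some true → n.unpair.1 ∈ S

variable {S : Set ℕ}

theorem Admissible.append {σ τ : List Bool} (hσ : Admissible S σ)
    (hτ : ∀ n : ℕ, τ[n]? = some true → (σ.length + n).unpair.1 ∈ S) : Admissible S (σ ++ τ) := by
  intro n hn
  rcases lt_or_ge n σ.length with h | h
  · rw [List.getElem?_append_left h] at hn
    exact hσ n hn
  · rw [List.getElem?_append_right h] at hn
    simpa [Nat.add_sub_cancel' h] using hτ _ hn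

/-- `σ` decides `D` among the admissible strings. -/
def Decides (S : Set ℕ) (D : Set (List Bool)) (σ : List Bool) : Prop :=
  σ ∈ D ∨ ∀ τ, Admissible S τ → σ <+: τ → τ ∉ D

/-- Either some admissible extension enters `D`, or `σ` itself already excludes `D`. Afterwards `j ∈
S` is recorded by padding with `false` up to a position coding `j`, followed by `true`. -/
theorem Admissible.exists_extension {σ : List Bool} (hσ : Admissible S σ) (D : Set (List Bool))
    (j : ℕ) : ∃ σ', Admissible S σ' ∧ σ <+: σ' ∧
      (∃ ρ, ρ <+: σ' ∧ Decides S D ρ) ∧ (j ∈ S → ∃ k, σ'[Nat.pair j k]? = some true) := by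
  obtain ⟨ρ, hρ, hσρ, hD⟩ : ∃ ρ, Admissible S ρ ∧ σ <+: ρ ∧ Decides S D ρ := by
    by_cases h : ∃ τ, Admissible S τ ∧ σ <+: τ ∧ τ ∈ D
    · obtain ⟨τ, h1, h2, h3⟩ := h
      exact ⟨τ, h1, h2, Or.inl h3⟩
    · exact ⟨σ, hσ, List.prefix_rfl, Or.inr fun τ h1 h2 h3 => h ⟨τ, h1, h2, h3⟩⟩
  by_cases hj : j ∈ S
  -- Choosing `ρ.length` as second coordinate places the new position past the end of `ρ`.
  · have hle : ρ.length ≤ Nat.pair j ρ.length := Nat.right_le_pair _ _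
    refine ⟨ρ ++ (List.replicate (Nat.pair j ρ.length - ρ.length) false ++ [true]), ?_,
      hσρ.trans (List.prefix_append _ _), ⟨ρ, List.prefix_append _ _, hD⟩,
      fun _ => ⟨ρ.length, ?_⟩⟩
    · refine hρ.append fun n hn => ?_
      have hn' : n = Nat.pair j ρ.length - ρ.length := by
        rcases lt_trichotomy n (Nat.pair j ρ.length - ρ.length) with h | h | h
        · rw [List.getElem?_append_left (by simpa using h)] at hn
          simp [h] at hn
        · exact h
        · rw [List.getElem?_eq_none (by simp; omega)] at hn
          simp at hn
      simpa [hn', Nat.add_sub_cancel' hle] using hj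
    · rw [List.getElem?_append_right hle, List.getElem?_append_right (by simp)]
      simp
  · refine ⟨ρ ++ [false], hρ.append fun n hn => ?_, hσρ.trans (List.prefix_append _ _),
      ⟨ρ, List.prefix_append _ _, hD⟩, fun h => absurd h hj⟩
    cases n <;> simp at hn

/-- A finite-extension construction: stage `j` decides `D j` and enumerates `j` if it belongs to
`S`. Admissibility of all stages prevents any other number from being enumerated. -/
theorem exists_generic_oracle (S : Set ℕ) (D : ℕ → Set (List Bool)) :
    ∃ O : Set ℕ, (∀ n, n ∈ S ↔ ∃ k, Nat.pair n k ∈ O) ∧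
      ∀ j, ∃ m, Decides S (D j) (oraclePrefix O m) := by
  classical
  choose! next hadm hpre hdec hmem using
    fun (j : ℕ) (σ : List Bool) (h : Admissible S σ) => h.exists_extension (D j) j
  let s : ℕ → List Bool := fun j => Nat.rec [] next j
  have hs : ∀ j, Admissible S (s j) := by
    intro j
    induction j with
    | zero => intro n hn; simp [s] at hn
    | succ j ih => exact hadm j _ ih
  have hmono : ∀ i j, i ≤ j → s i <+: s j := by
    intro i j h
    induction j, h using Nat.le_induction with
    | base => exact List.prefix_rfl
    | succ j _ ih => exact ih.trans (hpre j _ (hs j))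
  have hget : ∀ {i n : ℕ} {b : Bool}, (s i)[n]? = some b → ∀ {j}, i ≤ j → (s j)[n]? = some b := by
    intro i n b h j hij
    obtain ⟨ρ, hρ⟩ := hmono i j hij
    rw [← hρ, List.getElem?_append_left (List.getElem?_eq_some_iff.1 h).1, h]
  let O : Set ℕ := {n | ∃ j, (s j)[n]? = some true}
  have hO : ∀ {j n : ℕ} {b : Bool}, (s j)[n]? = some b → decide (n ∈ O) = b := by
    intro j n b h
    cases b with
    | true => simpa using ⟨j, h⟩
    | false =>
      simp only [decide_eq_false_iff_not]
      rintro ⟨i, hi⟩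
      have h1 := hget hi (le_max_left i j)
      rw [hget h (le_max_right i j)] at h1
      simp at h1
  -- The `false` bits are respected too, since the stages are compatible; each stage is thus a
  -- genuine prefix of `O`.
  have hOs : ∀ j, oraclePrefix O (s j).length = s j := by
    intro j
    refine List.ext_getElem (by simp) fun n h1 h2 => ?_
    have h3 := hO (List.getElem?_eq_getElem h2)
    simpa [oraclePrefix] using h3
  refine ⟨O, fun n => ⟨fun hn => ?_, ?_⟩, fun j => ?_⟩
  · obtain ⟨k, hk⟩ := hmem n _ (hs n) hn
    exact ⟨k, n + 1, hk⟩
  · rintro ⟨k, j, hj⟩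
    simpa using hs j _ hj
  · obtain ⟨ρ, hρ, hD⟩ := hdec j _ (hs j)
    refine ⟨ρ.length, ?_⟩
    have h1 : oraclePrefix O ρ.length <+: s (j + 1) := by
      rw [← hOs (j + 1)]
      exact oraclePrefix_prefix O hρ.length_le
    have h2 := List.prefix_of_prefix_length_le h1 hρ (by simp)
    rwa [h2.eq_of_length (by simp)]

end Generic

/-! ### The metric of the Hilbert cube -/

section Metric

theorem distQ_term_le (x y : HilbertCube) (i : ℕ) :
    (1 / 2 : ℝ) ^ i * |(x i : ℝ) - (y i : ℝ)| ≤ (1 / 2 : ℝ) ^ i := by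
  refine mul_le_of_le_one_right (by positivity) ?_
  rw [abs_le]
  constructor <;> linarith [(x i).2.1, (x i).2.2, (y i).2.1, (y i).2.2]

theorem summable_distQ (x y : HilbertCube) :
    Summable fun i : ℕ => (1 / 2 : ℝ) ^ i * |(x i : ℝ) - (y i : ℝ)| :=
  Summable.of_nonneg_of_le (fun _ => by positivity) (distQ_term_le x y) summable_geometric_two

theorem distQ_comm (x y : HilbertCube) : distQ x y = distQ y x := by
  simp [distQ, abs_sub_comm]

theorem distQ_self (x : HilbertCube) : distQ x x = 0 := by
  simp [distQ]

theorem distQ_triangle (x y z : HilbertCube) : distQ x z ≤ distQ x y + distQ y z := by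
  unfold distQ
  rw [← (summable_distQ x y).tsum_add (summable_distQ y z)]
  refine (summable_distQ x z).tsum_le_tsum (fun i => ?_)
    ((summable_distQ x y).add (summable_distQ y z))
  rw [← mul_add]
  exact mul_le_mul_of_nonneg_left (abs_sub_le _ _ _) (by positivity)

theorem distQ_le_two (x y : HilbertCube) : distQ x y ≤ 2 := by
  rw [← tsum_geometric_two]
  exact (summable_distQ x y).tsum_le_tsum (distQ_term_le x y) summable_geometric_two

theorem distQ_pos {x y : HilbertCube} (h : x ≠ y) : 0 < distQ x y := by
  obtain ⟨i, hi⟩ := Function.ne_iff.1 h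
  refine (summable_distQ x y).tsum_pos (fun _ => by positivity) i ?_
  have : (x i : ℝ) - y i ≠ 0 := fun h0 => hi (Subtype.ext (sub_eq_zero.1 h0))
  positivity

theorem continuous_distQ : Continuous fun p : HilbertCube × HilbertCube => distQ p.1 p.2 := by
  refine continuous_tsum (u := fun i => (1 / 2 : ℝ) ^ i) (fun i => by fun_prop)
    summable_geometric_two fun i p => ?_
  rw [Real.norm_of_nonneg (by positivity)]
  exact distQ_term_le p.1 p.2 i

theorem isOpen_ratBall (b : BallCode) : IsOpen (ratBall b) :=
  isOpen_lt (continuous_distQ.comp (Continuous.prodMk_right _)) continuous_const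

/-- The radius of a rational ball. -/
noncomputable def ratRadius (b : BallCode) : ℝ := ((b.2.1 : ℝ) + 1) / ((b.2.2 : ℝ) + 1)

theorem mem_ratBall {b : BallCode} {x : HilbertCube} :
    x ∈ ratBall b ↔ distQ (ratPoint b.1) x < ratRadius b := Iff.rfl

theorem coe_ratPoint (l : List (ℕ × ℕ)) (i : ℕ) :
    (ratPoint l i : ℝ) =
      ((min (l.getD i (0, 0)).1 ((l.getD i (0, 0)).2 + 1) : ℕ) : ℝ) /
        (((l.getD i (0, 0)).2 + 1 : ℕ) : ℝ) := by
  have h0 : (0 : unitInterval) = ratCoord (0, 0) := Subtype.ext (by simp [ratCoord])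
  have h : ratPoint l i = ratCoord (l.getD i (0, 0)) := by
    rw [ratPoint, h0, List.getD_map]
  rw [h]
  set c := l.getD i (0, 0)
  have hc : (0 : ℝ) < (c.2 : ℝ) + 1 := by positivity
  simp only [ratCoord]
  push_cast
  rw [← min_div_div_right hc.le, div_self hc.ne']

theorem exists_dist_ratPoint_le (x : HilbertCube) (N : ℕ) :
    ∃ l, ∀ i < N, dist (ratPoint l i : ℝ) (x i) ≤ 1 / ((N : ℝ) + 1) := by
  -- Each of the first `N` coordinates is rounded down to a multiple of `1 / (N + 1)`.
  refine ⟨(List.range N).map fun i => (⌊(x i : ℝ) * ((N : ℝ) + 1)⌋₊, N), fun i hi => ?_⟩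
  have hN : (0 : ℝ) < (N : ℝ) + 1 := by positivity
  have hx : 0 ≤ (x i : ℝ) * ((N : ℝ) + 1) := mul_nonneg (x i).2.1 hN.le
  have h1 := Nat.floor_le hx
  have h2 := Nat.lt_floor_add_one ((x i : ℝ) * ((N : ℝ) + 1))
  have hval : ratPoint ((List.range N).map fun i => (⌊(x i : ℝ) * ((N : ℝ) + 1)⌋₊, N)) i =
      ratCoord (⌊(x i : ℝ) * ((N : ℝ) + 1)⌋₊, N) := by
    simp [ratPoint, hi]
  rw [hval, ratCoord]
  generalize ⌊(x i : ℝ) * ((N : ℝ) + 1)⌋₊ = k at h1 h2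
  have hle : (k : ℝ) / ((N : ℝ) + 1) ≤ x i := (div_le_iff₀ hN).2 h1
  simp only [min_eq_left (hle.trans (x i).2.2)]
  rw [dist_comm, Real.dist_eq, abs_of_nonneg (sub_nonneg.2 hle), sub_le_iff_le_add, ← add_div,
    le_div_iff₀ hN]
  linarith

open Filter in
theorem exists_ratPoint_distQ_lt (x : HilbertCube) {ε : ℝ} (hε : 0 < ε) :
    ∃ l, distQ (ratPoint l) x < ε := by
  choose u hu using exists_dist_ratPoint_le x
  have hlim : Tendsto (fun N => ratPoint (u N)) atTop (nhds x) := by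
    refine tendsto_pi_nhds.2 fun i => tendsto_subtype_rng.2 (tendsto_iff_dist_tendsto_zero.2 ?_)
    refine squeeze_zero' (Eventually.of_forall fun _ => dist_nonneg) ?_
      (tendsto_one_div_add_atTop_nhds_zero_nat (𝕜 := ℝ))
    exact (eventually_gt_atTop i).mono fun N hN => hu N i hN
  have hc : Continuous fun y => distQ y x := continuous_distQ.comp (Continuous.prodMk_left x)
  have hd := (hc.tendsto x).comp hlim
  rw [distQ_self] at hd
  obtain ⟨N, hN⟩ := (hd.eventually_lt_const hε).exists
  exact ⟨u N, hN⟩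

theorem exists_mem_ratBall (x : HilbertCube) {ε : ℝ} (hε : 0 < ε) :
    ∃ b, x ∈ ratBall b ∧ ratRadius b < ε := by
  obtain ⟨n, hn⟩ := exists_nat_one_div_lt hε
  obtain ⟨l, hl⟩ := exists_ratPoint_distQ_lt x (ε := 1 / ((n : ℝ) + 1)) (by positivity)
  exact ⟨(l, (0, n)), by simpa [mem_ratBall, ratRadius] using hl, by simpa [ratRadius] using hn⟩

/-- The property `G` holds of all sufficiently small rational balls that contain `x`. -/
def HoldsNear (x : HilbertCube) (G : BallCode → Prop) : Prop :=
  ∃ ε > 0, ∀ b, x ∈ ratBall b → ratRadius b < ε → G b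

theorem HoldsNear.and {x : HilbertCube} {G H : BallCode → Prop} (hG : HoldsNear x G)
    (hH : HoldsNear x H) : HoldsNear x fun b => G b ∧ H b := by
  obtain ⟨ε, hε, hG⟩ := hG
  obtain ⟨δ, hδ, hH⟩ := hH
  exact ⟨min ε δ, lt_min hε hδ, fun b hb hr =>
    ⟨hG b hb (hr.trans_le (min_le_left _ _)), hH b hb (hr.trans_le (min_le_right _ _))⟩⟩

theorem holdsNear_forall_mem_list {ι : Type*} {x : HilbertCube} {G : ι → BallCode → Prop}
    {L : List ι} (h : ∀ i ∈ L, HoldsNear x (G i)) : HoldsNear x fun b => ∀ i ∈ L, G i b := by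
  induction L with
  | nil => exact ⟨1, one_pos, by simp⟩
  | cons i L ih =>
    simp only [List.forall_mem_cons] at h ⊢
    exact h.1.and (ih h.2)

theorem HoldsNear.mono {x : HilbertCube} {G H : BallCode → Prop} (hG : HoldsNear x G)
    (h : ∀ b, G b → H b) : HoldsNear x H := by
  obtain ⟨ε, hε, hG⟩ := hG
  exact ⟨ε, hε, fun b hb hr => h b (hG b hb hr)⟩

/-- Compactness turns a property of all small balls around each point into a finite cover by balls
with that property. -/
theorem exists_ratUnion_of_holdsNear {K : Set HilbertCube} (hK : IsCompact K)
    {G : BallCode → Prop} (h : ∀ x ∈ K, HoldsNear x G) :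
    ∃ l : List BallCode, (∀ b ∈ l, G b) ∧ K ⊆ ratUnion l := by
  have hb : ∀ x ∈ K, ∃ b, G b ∧ x ∈ ratBall b := by
    intro x hx
    obtain ⟨ε, hε, hG⟩ := h x hx
    obtain ⟨b, hxb, hr⟩ := exists_mem_ratBall x hε
    exact ⟨b, hG b hxb hr, hxb⟩
  choose! β hβG hβ using hb
  obtain ⟨t, htK, ht⟩ := hK.elim_nhds_subcover (fun x => ratBall (β x))
    fun x hx => (isOpen_ratBall _).mem_nhds (hβ x hx)
  refine ⟨t.toList.map β, ?_, fun x hx => ?_⟩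
  · simpa using fun x hx => hβG x (htK x hx)
  · obtain ⟨y, hy, hxy⟩ := Set.mem_iUnion₂.1 (ht hx)
    exact ⟨β y, List.mem_map.2 ⟨y, by simpa using hy, rfl⟩, hxy⟩

end Metric

/-! ### Formal inclusion and disjointness of rational balls -/

section Formal

/-- Numerator and denominator of a partial sum of the series that defines the distance of two
rational points. -/
def distFrac (l l' : List (ℕ × ℕ)) (n : ℕ) : ℕ × ℕ :=
  n.rec (0, 1) fun i s =>
    let p := min (l.getD i (0, 0)).1 ((l.getD i (0, 0)).2 + 1)
    let q := (l.getD i (0, 0)).2 + 1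
    let p' := min (l'.getD i (0, 0)).1 ((l'.getD i (0, 0)).2 + 1)
    let q' := (l'.getD i (0, 0)).2 + 1
    let e := q * q' * 2 ^ i
    (s.1 * e + ((p * q' - p' * q) + (p' * q - p * q')) * s.2, s.2 * e)

theorem distFrac_snd_pos (l l' : List (ℕ × ℕ)) (n : ℕ) : 0 < (distFrac l l' n).2 := by
  induction n with
  | zero => exact one_pos
  | succ n ih => simp only [distFrac] at ih ⊢; positivity

/-- One of the two truncated differences vanishes; this lets `distFrac` compute absolute values
within `ℕ`. -/
theorem cast_tsub_add_tsub (a b : ℕ) : ((a - b + (b - a) : ℕ) : ℝ) = |(a : ℝ) - b| := by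
  rcases le_total a b with h | h
  · rw [Nat.sub_eq_zero_of_le h, zero_add, Nat.cast_sub h, abs_sub_comm, abs_of_nonneg]
    exact sub_nonneg.2 (Nat.cast_le.2 h)
  · rw [Nat.sub_eq_zero_of_le h, add_zero, Nat.cast_sub h, abs_of_nonneg]
    exact sub_nonneg.2 (Nat.cast_le.2 h)

theorem distFrac_eq_sum (l l' : List (ℕ × ℕ)) (n : ℕ) :
    ((distFrac l l' n).1 : ℝ) / (distFrac l l' n).2 = ∑ i ∈ Finset.range n,
      (1 / 2 : ℝ) ^ i * |(ratPoint l i : ℝ) - (ratPoint l' i : ℝ)| := by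
  induction n with
  | zero => simp [distFrac]
  | succ n ih =>
    rw [Finset.sum_range_succ, ← ih, coe_ratPoint, coe_ratPoint]
    have hpos := distFrac_snd_pos l l' n
    change ((_ * _ + _ * _ : ℕ) : ℝ) / ((_ * _ : ℕ) : ℝ) = _
    change (((distFrac l l' n).1 * _ + _ * (distFrac l l' n).2 : ℕ) : ℝ) /
      (((distFrac l l' n).2 * _ : ℕ) : ℝ) = _
    generalize distFrac l l' n = s at hpos ⊢
    generalize min (l.getD n (0, 0)).1 ((l.getD n (0, 0)).2 + 1) = p
    generalize min (l'.getD n (0, 0)).1 ((l'.getD n (0, 0)).2 + 1) = p'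
    generalize hq : (l.getD n (0, 0)).2 + 1 = q
    generalize hq' : (l'.getD n (0, 0)).2 + 1 = q'
    have hq0 : (0 : ℝ) < q := by rw [← hq]; positivity
    have hq0' : (0 : ℝ) < q' := by rw [← hq']; positivity
    have hs : (0 : ℝ) < s.2 := Nat.cast_pos.2 hpos
    rw [div_sub_div _ _ hq0.ne' hq0'.ne', abs_div, abs_of_pos (mul_pos hq0 hq0'),
      mul_comm (q : ℝ) (p' : ℝ), one_div, inv_pow, Nat.cast_add, Nat.cast_mul, Nat.cast_mul _ s.2,
      cast_tsub_add_tsub]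
    push_cast
    field_simp

/-- Beyond both lists all coordinates are `0`, so the series is a finite sum and the distance is a
computable fraction. -/
theorem distQ_ratPoint (l l' : List (ℕ × ℕ)) :
    distQ (ratPoint l) (ratPoint l') = ((distFrac l l' (l.length + l'.length)).1 : ℝ) /
      (distFrac l l' (l.length + l'.length)).2 := by
  rw [distFrac_eq_sum, distQ]
  refine tsum_eq_sum fun i hi => ?_
  simp only [Finset.mem_range, not_lt] at hi
  rw [coe_ratPoint, coe_ratPoint, List.getD_eq_default _ _ (by omega),
    List.getD_eq_default _ _ (by omega)]
  simp

/-- A decidable condition that implies that the first ball is contained in the second one. -/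
def FormallyInside (b b' : BallCode) : Prop :=
  (distFrac b.1 b'.1 (b.1.length + b'.1.length)).1 * (b.2.2 + 1) * (b'.2.2 + 1) +
    (b.2.1 + 1) * (distFrac b.1 b'.1 (b.1.length + b'.1.length)).2 * (b'.2.2 + 1) ≤
  (b'.2.1 + 1) * (distFrac b.1 b'.1 (b.1.length + b'.1.length)).2 * (b.2.2 + 1)

/-- A decidable condition that implies that two balls are disjoint. -/
def FormallyDisjoint (b b' : BallCode) : Prop :=
  (b.2.1 + 1) * (distFrac b.1 b'.1 (b.1.length + b'.1.length)).2 * (b'.2.2 + 1) +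
    (b'.2.1 + 1) * (distFrac b.1 b'.1 (b.1.length + b'.1.length)).2 * (b.2.2 + 1) ≤
  (distFrac b.1 b'.1 (b.1.length + b'.1.length)).1 * (b.2.2 + 1) * (b'.2.2 + 1)

/-- Clearing positive denominators turns the inequality between rationals into one between natural
numbers, decidable on codes. -/
theorem formallyInside_iff {b b' : BallCode} : FormallyInside b b' ↔
    distQ (ratPoint b.1) (ratPoint b'.1) + ratRadius b ≤ ratRadius b' := by
  rw [distQ_ratPoint, ratRadius, ratRadius, FormallyInside]
  have h := distFrac_snd_pos b.1 b'.1 (b.1.length + b'.1.length)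
  generalize distFrac b.1 b'.1 (b.1.length + b'.1.length) = s at h ⊢
  have hs : (0 : ℝ) < s.2 := Nat.cast_pos.2 h
  rw [div_add_div _ _ hs.ne' (by positivity), div_le_div_iff₀ (by positivity) (by positivity),
    ← Nat.cast_le (α := ℝ)]
  push_cast
  ring_nf

theorem formallyDisjoint_iff {b b' : BallCode} : FormallyDisjoint b b' ↔
    ratRadius b + ratRadius b' ≤ distQ (ratPoint b.1) (ratPoint b'.1) := by
  rw [distQ_ratPoint, ratRadius, ratRadius, FormallyDisjoint]
  have h := distFrac_snd_pos b.1 b'.1 (b.1.length + b'.1.length)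
  generalize distFrac b.1 b'.1 (b.1.length + b'.1.length) = s at h ⊢
  have hs : (0 : ℝ) < s.2 := Nat.cast_pos.2 h
  rw [div_add_div _ _ (by positivity) (by positivity), div_le_div_iff₀ (by positivity) hs,
    ← Nat.cast_le (α := ℝ)]
  push_cast
  ring_nf

theorem FormallyInside.subset {b b' : BallCode} (h : FormallyInside b b') :
    ratBall b ⊆ ratBall b' := by
  intro x hx
  rw [mem_ratBall] at hx ⊢
  rw [formallyInside_iff, distQ_comm] at h
  linarith [distQ_triangle (ratPoint b'.1) (ratPoint b.1) x]

theorem FormallyDisjoint.not_mem {b b' : BallCode} (h : FormallyDisjoint b b')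
    {x : HilbertCube} (hx : x ∈ ratBall b) : x ∉ ratBall b' := by
  intro hx'
  rw [mem_ratBall] at hx hx'
  rw [formallyDisjoint_iff] at h
  rw [distQ_comm] at hx'
  linarith [distQ_triangle (ratPoint b.1) x (ratPoint b'.1)]

theorem holdsNear_formallyInside {b : BallCode} {x : HilbertCube} (hx : x ∈ ratBall b) :
    HoldsNear x fun b' => FormallyInside b' b := by
  rw [mem_ratBall] at hx
  -- Half the slack: the small radius is spent twice, on reaching the centre of `b'` from `x` and on
  -- the radius of `b'`.
  refine ⟨(ratRadius b - distQ (ratPoint b.1) x) / 2, by linarith, fun b' hb' hr => ?_⟩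
  rw [mem_ratBall] at hb'
  rw [formallyInside_iff]
  linarith [distQ_triangle (ratPoint b'.1) x (ratPoint b.1), distQ_comm x (ratPoint b.1)]

theorem holdsNear_formallyDisjoint {b : BallCode} {x : HilbertCube}
    (hx : ratRadius b < distQ (ratPoint b.1) x) :
    HoldsNear x fun b' => FormallyDisjoint b b' := by
  refine ⟨(distQ (ratPoint b.1) x - ratRadius b) / 2, by linarith, fun b' hb' hr => ?_⟩
  rw [mem_ratBall] at hb'
  rw [formallyDisjoint_iff]
  linarith [distQ_triangle (ratPoint b.1) (ratPoint b'.1) x]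

theorem exists_ratBall_away {K : Set HilbertCube} (hK : IsCompact K) {y : HilbertCube}
    (hy : y ∉ K) : ∃ b, y ∈ ratBall b ∧ ∀ x ∈ K, ratRadius b < distQ (ratPoint b.1) x := by
  rcases K.eq_empty_or_nonempty with rfl | hne
  · obtain ⟨b, hb, -⟩ := exists_mem_ratBall y one_pos
    exact ⟨b, hb, by simp⟩
  · obtain ⟨z, hz, hmin⟩ := hK.exists_isMinOn hne
      (continuous_distQ.comp (Continuous.prodMk_right y)).continuousOn
    have hpos : 0 < distQ y z := distQ_pos fun h => hy (h ▸ hz)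
    -- With a radius below half the distance from `y` to `K`, every point of `K` is farther from the
    -- centre than the radius.
    obtain ⟨b, hb, hr⟩ := exists_mem_ratBall y (half_pos hpos)
    refine ⟨b, hb, fun x hx => ?_⟩
    have h1 : distQ y z ≤ distQ y x := hmin hx
    rw [mem_ratBall, distQ_comm] at hb
    linarith [distQ_triangle y (ratPoint b.1) x]

/-- Formal inclusion of basic sets of the square of the upper Vietoris topology. -/
def FormallyRefines (i j : List BallCode × List BallCode) : Prop :=
  (∀ b ∈ i.1, ∃ b' ∈ j.1, FormallyInside b b') ∧ ∀ b ∈ i.2, ∃ b' ∈ j.2, FormallyInside b b'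

theorem ratUnion_subset_ratUnion {l l' : List BallCode}
    (h : ∀ b ∈ l, ∃ b' ∈ l', FormallyInside b b') : ratUnion l ⊆ ratUnion l' := by
  rintro x ⟨b, hb, hx⟩
  obtain ⟨b', hb', hbb'⟩ := h b hb
  exact ⟨b', hb', hbb'.subset hx⟩

theorem FormallyRefines.subset {i j : List BallCode × List BallCode} (h : FormallyRefines i j) :
    upVietorisSqBasis i ⊆ upVietorisSqBasis j := fun _ hq =>
  ⟨hq.1.trans (ratUnion_subset_ratUnion h.1), hq.2.trans (ratUnion_subset_ratUnion h.2)⟩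

theorem holdsNear_exists_formallyInside {l : List BallCode} {x : HilbertCube}
    (hx : x ∈ ratUnion l) : HoldsNear x fun b => ∃ b' ∈ l, FormallyInside b b' := by
  obtain ⟨b', hb', hx⟩ := hx
  exact (holdsNear_formallyInside hx).mono fun b hb => ⟨b', hb', hb⟩

/-- Formal relations are stronger than inclusion and disjointness of sets, but covers by
sufficiently small balls achieve them, so nothing is lost by using the decidable versions. -/
theorem exists_formallyRefines {q : Compacts HilbertCube × Compacts HilbertCube}
    {L : List (List BallCode × List BallCode)} (hL : ∀ j ∈ L, q ∈ upVietorisSqBasis j)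
    {b : BallCode} (hb : ∀ x ∈ q.1, ratRadius b < distQ (ratPoint b.1) x) :
    ∃ i, q ∈ upVietorisSqBasis i ∧ (∀ j ∈ L, FormallyRefines i j) ∧
      ∀ b' ∈ i.1, FormallyDisjoint b b' := by
  obtain ⟨l₁, h₁, hq₁⟩ := exists_ratUnion_of_holdsNear q.1.isCompact fun x hx =>
    (holdsNear_forall_mem_list fun j hj => holdsNear_exists_formallyInside ((hL j hj).1 hx)).and
      (holdsNear_formallyDisjoint (hb x hx))
  obtain ⟨l₂, h₂, hq₂⟩ := exists_ratUnion_of_holdsNear q.2.isCompact fun x hx =>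
    holdsNear_forall_mem_list fun j hj => holdsNear_exists_formallyInside ((hL j hj).2 hx)
  exact ⟨(l₁, l₂), ⟨hq₁, hq₂⟩, fun j hj => ⟨fun b hb => (h₁ b hb).1 j hj, fun b hb => h₂ b hb j hj⟩,
    fun b hb => (h₁ b hb).2⟩

/-! ### Primitive recursiveness of the formal relations -/

theorem primrec_two_pow : Primrec fun n : ℕ => 2 ^ n := by
  refine (Primrec.nat_rec₁ (f := fun _ m => 2 * m) 1
    (Primrec.nat_double.comp Primrec.snd)).of_eq fun n => ?_
  induction n with
  | zero => rfl
  | succ n ih => rw [pow_succ', ← ih]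

theorem primrec_distFrac :
    Primrec fun x : (List (ℕ × ℕ) × List (ℕ × ℕ)) × ℕ => distFrac x.1.1 x.1.2 x.2 := by
  let α := (List (ℕ × ℕ) × List (ℕ × ℕ)) × ℕ
  have hi : Primrec fun x : α × ℕ × ℕ × ℕ => x.2.1 := Primrec.fst.comp Primrec.snd
  have hs : Primrec fun x : α × ℕ × ℕ × ℕ => x.2.2 := Primrec.snd.comp Primrec.snd
  have hc : Primrec fun x : α × ℕ × ℕ × ℕ => x.1.1.1.getD x.2.1 (0, 0) :=
    (Primrec.list_getD _).comp (Primrec.fst.comp (Primrec.fst.comp Primrec.fst)) hi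
  have hc' : Primrec fun x : α × ℕ × ℕ × ℕ => x.1.1.2.getD x.2.1 (0, 0) :=
    (Primrec.list_getD _).comp (Primrec.snd.comp (Primrec.fst.comp Primrec.fst)) hi
  have hq := Primrec.succ.comp (Primrec.snd.comp hc)
  have hq' := Primrec.succ.comp (Primrec.snd.comp hc')
  have hp := Primrec.nat_min.comp (Primrec.fst.comp hc) hq
  have hp' := Primrec.nat_min.comp (Primrec.fst.comp hc') hq'
  have he := Primrec.nat_mul.comp (Primrec.nat_mul.comp hq hq') (primrec_two_pow.comp hi)
  have h₁ := Primrec.nat_mul.comp hp hq'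
  have h₂ := Primrec.nat_mul.comp hp' hq
  have ht := Primrec.nat_add.comp (Primrec.nat_sub.comp h₁ h₂) (Primrec.nat_sub.comp h₂ h₁)
  exact Primrec.nat_rec' (f := fun x : α => x.2) Primrec.snd (Primrec.const (0, 1))
    (Primrec.pair (Primrec.nat_add.comp (Primrec.nat_mul.comp (Primrec.fst.comp hs) he)
      (Primrec.nat_mul.comp ht (Primrec.snd.comp hs)))
      (Primrec.nat_mul.comp (Primrec.snd.comp hs) he)).to₂

theorem primrec_distFrac_ball : Primrec fun x : BallCode × BallCode =>
    distFrac x.1.1 x.2.1 (x.1.1.length + x.2.1.length) := by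
  have h₁ : Primrec fun x : BallCode × BallCode => x.1.1 := Primrec.fst.comp Primrec.fst
  have h₂ : Primrec fun x : BallCode × BallCode => x.2.1 := Primrec.fst.comp Primrec.snd
  have h₃ : Primrec fun x : BallCode × BallCode => x.1.1.length + x.2.1.length :=
    Primrec.nat_add.comp (Primrec.list_length.comp h₁) (Primrec.list_length.comp h₂)
  exact Primrec.comp (f := fun x : (List (ℕ × ℕ) × List (ℕ × ℕ)) × ℕ => distFrac x.1.1 x.1.2 x.2)
    (g := fun x : BallCode × BallCode => ((x.1.1, x.2.1), x.1.1.length + x.2.1.length))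
    primrec_distFrac ((h₁.pair h₂).pair h₃)

theorem primrecRel_formallyInside : PrimrecRel FormallyInside := by
  have h₁ := Primrec.fst.comp primrec_distFrac_ball
  have h₂ := Primrec.snd.comp primrec_distFrac_ball
  have hb : Primrec fun x : BallCode × BallCode => x.1.2 := Primrec.snd.comp Primrec.fst
  have hb' : Primrec fun x : BallCode × BallCode => x.2.2 := Primrec.snd.comp Primrec.snd
  have hr := Primrec.succ.comp (Primrec.fst.comp hb)
  have hs := Primrec.succ.comp (Primrec.snd.comp hb)
  have hr' := Primrec.succ.comp (Primrec.fst.comp hb')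
  have hs' := Primrec.succ.comp (Primrec.snd.comp hb')
  exact Primrec.nat_le.comp (Primrec.nat_add.comp
      (Primrec.nat_mul.comp (Primrec.nat_mul.comp h₁ hs) hs')
      (Primrec.nat_mul.comp (Primrec.nat_mul.comp hr h₂) hs'))
    (Primrec.nat_mul.comp (Primrec.nat_mul.comp hr' h₂) hs)

theorem primrecRel_formallyDisjoint : PrimrecRel FormallyDisjoint := by
  have h₁ := Primrec.fst.comp primrec_distFrac_ball
  have h₂ := Primrec.snd.comp primrec_distFrac_ball
  have hb : Primrec fun x : BallCode × BallCode => x.1.2 := Primrec.snd.comp Primrec.fst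
  have hb' : Primrec fun x : BallCode × BallCode => x.2.2 := Primrec.snd.comp Primrec.snd
  have hr := Primrec.succ.comp (Primrec.fst.comp hb)
  have hs := Primrec.succ.comp (Primrec.snd.comp hb)
  have hr' := Primrec.succ.comp (Primrec.fst.comp hb')
  have hs' := Primrec.succ.comp (Primrec.snd.comp hb')
  exact Primrec.nat_le.comp (Primrec.nat_add.comp
      (Primrec.nat_mul.comp (Primrec.nat_mul.comp hr h₂) hs')
      (Primrec.nat_mul.comp (Primrec.nat_mul.comp hr' h₂) hs))
    (Primrec.nat_mul.comp (Primrec.nat_mul.comp h₁ hs) hs')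

theorem primrecRel_formallyRefines : PrimrecRel FormallyRefines := by
  have h : PrimrecRel fun l l' : List BallCode => ∀ b ∈ l, ∃ b' ∈ l', FormallyInside b b' :=
    primrecRel_formallyInside.swap.exists_mem_list.swap.forall_mem_list
  exact PrimrecPred.and
    (h.comp (Primrec.fst.comp Primrec.fst) (Primrec.fst.comp Primrec.snd))
    (h.comp (Primrec.snd.comp Primrec.fst) (Primrec.snd.comp Primrec.snd))

end Formal

/-! ### Minimality, overtness and the generic construction -/

section Main

theorem REPredIn.of_iff {α : Type*} [Primcodable α] {O : Set ℕ} {p p' : α → Prop}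
    (hp : REPredIn O p) (h : ∀ a, p a ↔ p' a) : REPredIn O p' :=
  (funext fun a => propext (h a) : p = p') ▸ hp

theorem IsCopy.isPair {X : Type*} [TopologicalSpace X] {A : Set X}
    {q : Compacts HilbertCube × Compacts HilbertCube} (h : IsCopy A q) : IsPair q := by
  obtain ⟨f, hf⟩ := h
  rw [IsPair, ← hf]
  rintro _ ⟨x, -, rfl⟩
  exact (f x).2

theorem ratUnion_cons (b : BallCode) (l : List BallCode) :
    ratUnion (b :: l) = ratBall b ∪ ratUnion l := by
  ext x
  simp [ratUnion]

/-- A list of rational balls that covers the Hilbert cube. -/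
def fullCover : List BallCode := [([], (2, 0))]

theorem ratUnion_fullCover : ratUnion fullCover = Set.univ := by
  refine Set.eq_univ_of_forall fun x => ⟨_, List.mem_singleton_self _, ?_⟩
  rw [mem_ratBall, ratRadius]
  -- The coded radius is `3`, whereas distances are at most `2`.
  have := distQ_le_two (ratPoint []) x
  norm_num
  linarith

/-- The pair obtained by removing an open ball. -/
def removeBall (q : Compacts HilbertCube × Compacts HilbertCube) (b : BallCode) :
    Compacts HilbertCube × Compacts HilbertCube :=
  (⟨q.1 \ ratBall b, q.1.isCompact.diff (isOpen_ratBall b)⟩,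
    ⟨q.2 \ ratBall b, q.2.isCompact.diff (isOpen_ratBall b)⟩)

theorem removeBall_mem_basis {q : Compacts HilbertCube × Compacts HilbertCube} {b : BallCode}
    {i : List BallCode × List BallCode} :
    removeBall q b ∈ upVietorisSqBasis i ↔
      (q.1 : Set HilbertCube) ⊆ ratUnion (b :: i.1) ∧
        (q.2 : Set HilbertCube) ⊆ ratUnion (b :: i.2) := by
  simp only [ratUnion_cons, ← Set.sdiff_subset_iff]
  rfl

/-- A ball that misses `q.1` also misses `q.2`, so its removal changes nothing; a ball that meets
`q.1` leaves a proper subpair. -/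
theorem IsMinimalFor.removeBall_mem_iff {P : Set (Compacts HilbertCube × Compacts HilbertCube)}
    {q : Compacts HilbertCube × Compacts HilbertCube} (hq : IsPair q) (hP : IsMinimalFor P q)
    (b : BallCode) : removeBall q b ∉ P ↔ ((q.1 : Set HilbertCube) ∩ ratBall b).Nonempty := by
  constructor
  · intro h
    by_contra hne
    rw [Set.not_nonempty_iff_eq_empty, ← Set.disjoint_iff_inter_eq_empty] at hne
    have : removeBall q b = q :=
      Prod.ext (Compacts.ext hne.sdiff_eq_left) (Compacts.ext (hne.mono_left hq).sdiff_eq_left)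
    rw [this] at h
    exact h hP.1
  · rintro ⟨x, hx, hxb⟩
    refine hP.2 _ ⟨Set.sdiff_subset_sdiff_left hq, ⟨Set.sdiff_subset, fun h => (h hx).2 hxb⟩,
      Set.sdiff_subset⟩

theorem UniformlyPi01.computableCompactIn {P : ℕ → Set (Compacts HilbertCube × Compacts HilbertCube)}
    (hP : UniformlyPi01 upVietorisSqBasis P) {q : Compacts HilbertCube × Compacts HilbertCube}
    (hq : IsPair q) {n : ℕ} (hn : IsMinimalFor (P n) q) {O : Set ℕ}
    (h₁ : SemicomputableIn O q.1) (h₂ : SemicomputableIn O q.2) : ComputableCompactIn O q.1 := by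
  refine ⟨h₁, ?_⟩
  obtain ⟨W, hW, hPW⟩ := hP
  obtain ⟨R₁, hR₁, hm₁, he₁⟩ := REPredIn.exists_rePred h₁
  obtain ⟨R₂, hR₂, hm₂, he₂⟩ := REPredIn.exists_rePred h₂
  let I := List BallCode × List BallCode
  let R : BallCode × List Bool → Prop := fun x => ∃ i : I,
    W (n, i) ∧ R₁ (x.1 :: i.1, x.2) ∧ R₂ (x.1 :: i.2, x.2)
  have hR : REPred R := by
    have hb : Computable fun y : (BallCode × List Bool) × I => y.1.1 :=
      Computable.fst.comp Computable.fst
    have hσ : Computable fun y : (BallCode × List Bool) × I => y.1.2 :=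
      Computable.snd.comp Computable.fst
    refine REPred.exists (p := fun y : (BallCode × List Bool) × I =>
      W (n, y.2) ∧ R₁ (y.1.1 :: y.2.1, y.1.2) ∧ R₂ (y.1.1 :: y.2.2, y.1.2)) ?_
    refine (hW.comp ((Computable.const n).pair Computable.snd)).and ((hR₁.comp ?_).and
      (hR₂.comp ?_))
    · exact (Computable.list_cons.comp hb (Computable.fst.comp Computable.snd)).pair hσ
    · exact (Computable.list_cons.comp hb (Computable.snd.comp Computable.snd)).pair hσ
  refine (rePredIn_of_rePred (O := O) hR).of_iff fun b => ?_
  rw [← hn.removeBall_mem_iff hq, ← Set.mem_compl_iff, hPW n]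
  simp only [Set.mem_iUnion, removeBall_mem_basis, he₁, he₂, R]
  constructor
  · rintro ⟨m, i, hi, hi₁, hi₂⟩
    exact ⟨i, hi, ⟨m, hi₁⟩, ⟨m, hi₂⟩⟩
  · rintro ⟨i, hi, ⟨m, hi₁⟩, ⟨m', hi₂⟩⟩
    exact ⟨max m m', i, hi, hm₁ _ _ _ (oraclePrefix_prefix O (le_max_left _ _)) hi₁,
      hm₂ _ _ _ (oraclePrefix_prefix O (le_max_right _ _)) hi₂⟩

/-- The `n`-th closed set of the square of the upper Vietoris topology, for a universal numbering of
the effectively closed sets. -/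
def universalPi01 (n : ℕ) : Set (Compacts HilbertCube × Compacts HilbertCube) :=
  {q | ∀ i, ((ofNat Code n).eval (encode i)).Dom → q ∉ upVietorisSqBasis i}

theorem uniformlyPi01_universalPi01 : UniformlyPi01 upVietorisSqBasis universalPi01 := by
  refine ⟨fun x => ((ofNat Code x.1).eval (encode x.2)).Dom, ?_, fun n => ?_⟩
  · exact (Code.eval_part.comp ((Computable.ofNat Code).comp Computable.fst)
      (Computable.encode.comp Computable.snd)).dom_re
  · ext q
    simp [universalPi01]

theorem exists_universalPi01_eq {w : List BallCode × List BallCode → Prop} (hw : REPred w) :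
    ∃ n, universalPi01 n = {q | ∀ i, w i → q ∉ upVietorisSqBasis i} := by
  obtain ⟨c, hc⟩ := rePred_iff_exists_code.1 hw
  exact ⟨encode c, by simp only [universalPi01, ofNat_encode, hc]⟩

theorem UniformlyPi01.isSigma02_iUnion
    {P : ℕ → Set (Compacts HilbertCube × Compacts HilbertCube)}
    (hP : UniformlyPi01 upVietorisSqBasis P) : IsSigma02 upVietorisSqBasis (⋃ n, P n) := by
  -- Nothing is subtracted; the empty set is effectively closed because one basic set is the whole
  -- space.
  refine ⟨P, fun _ => ∅, hP, ⟨fun x => x.2 = (fullCover, fullCover), ?_, fun n => ?_⟩, by simp⟩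
  · exact (Primrec.eq.comp Primrec.snd (Primrec.const _)).rePred
  · simp [upVietorisSqBasis, ratUnion_fullCover]

/-- As the empty set of indices is c.e., the whole space occurs among the effectively closed
sets. -/
theorem iUnion_universalPi01 : ⋃ n, universalPi01 n = Set.univ := by
  obtain ⟨n, hn⟩ := exists_universalPi01_eq (w := fun _ => False)
    (PrimrecPred.rePred ⟨fun _ => inferInstanceAs (Decidable False), Primrec.const _⟩)
  exact Set.eq_univ_of_forall fun q => Set.mem_iUnion.2 ⟨n, by simp [hn]⟩

/-- The basic sets that a string declares to be neighbourhoods. -/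
def declared (τ : List Bool) : List (List BallCode × List BallCode) :=
  (List.range τ.length).filterMap fun n =>
    bif (τ[n]?).getD false then decode n.unpair.1 else none

theorem mem_declared {τ : List Bool} {j : List BallCode × List BallCode} :
    j ∈ declared τ ↔ ∃ n : ℕ, τ[n]? = some true ∧ decode n.unpair.1 = some j := by
  simp only [declared, List.mem_filterMap, List.mem_range]
  constructor
  · rintro ⟨n, -, hn⟩
    cases h : (τ[n]?).getD false with
    | false =>
      rw [h] at hn
      simp at hn
    | true =>
      rw [h] at hn
      refine ⟨n, ?_, hn⟩
      cases h' : τ[n]? <;> simp_all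
  · rintro ⟨n, h, hn⟩
    refine ⟨n, (List.getElem?_eq_some_iff.1 h).1, ?_⟩
    rw [h]
    exact hn

theorem primrec_declared : Primrec declared := by
  refine Primrec.listFilterMap (Primrec.list_range.comp Primrec.list_length) ?_
  exact Primrec.cond (Primrec.option_getD.comp (Primrec.list_getElem?.comp Primrec.fst Primrec.snd)
    (Primrec.const _)) (Primrec.decode.comp (Primrec.fst.comp (Primrec.unpair.comp Primrec.snd)))
    (Primrec.const _)

/-- The indices of the basic neighbourhoods of a pair. -/
def neighbourhoodCodes (q : Compacts HilbertCube × Compacts HilbertCube) : Set ℕ :=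
  {n | ∃ i, decode n = some i ∧ q ∈ upVietorisSqBasis i}

theorem encode_mem_neighbourhoodCodes {q : Compacts HilbertCube × Compacts HilbertCube}
    {i : List BallCode × List BallCode} :
    encode i ∈ neighbourhoodCodes q ↔ q ∈ upVietorisSqBasis i := by
  simp only [neighbourhoodCodes, Set.mem_ofPred_eq, encodek, Option.some.injEq, exists_eq_left']

theorem Admissible.mem_upVietorisSqBasis {q : Compacts HilbertCube × Compacts HilbertCube}
    {τ : List Bool} (h : Admissible (neighbourhoodCodes q) τ) :
    ∀ j ∈ declared τ, q ∈ upVietorisSqBasis j := by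
  intro j hj
  obtain ⟨n, hn, hj⟩ := mem_declared.1 hj
  obtain ⟨i, hi, hq⟩ := h n hn
  rw [hi] at hj
  rwa [← Option.some.inj hj]

/-- To be applied with `f` inserting `fullCover` in the other component: covers of one component
then become basic neighbourhoods of `q`, which `O` enumerates. -/
theorem semicomputableIn_of_enumerates {q : Compacts HilbertCube × Compacts HilbertCube}
    {O : Set ℕ} (hO : ∀ n, n ∈ neighbourhoodCodes q ↔ ∃ k, Nat.pair n k ∈ O)
    {K : Compacts HilbertCube} {f : List BallCode → List BallCode × List BallCode}
    (hf : Primrec f) (hK : ∀ l, (K : Set HilbertCube) ⊆ ratUnion l ↔ q ∈ upVietorisSqBasis (f l)) :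
    SemicomputableIn O K := by
  have hR : REPred fun x : List BallCode × List Bool =>
      ∃ k : ℕ, x.2[Nat.pair (encode (f x.1)) k]? = some true := by
    refine REPred.exists (p := fun y : (List BallCode × List Bool) × ℕ =>
      y.1.2[Nat.pair (encode (f y.1.1)) y.2]? = some true) (PrimrecPred.rePred ?_)
    exact Primrec.eq.comp (Primrec.list_getElem?.comp (Primrec.snd.comp Primrec.fst)
      (Primrec₂.natPair.comp (Primrec.encode.comp (hf.comp (Primrec.fst.comp Primrec.fst)))
        Primrec.snd)) (Primrec.const _)
  refine (rePredIn_of_rePred (O := O) hR).of_iff fun l => ?_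
  rw [hK, ← encode_mem_neighbourhoodCodes, hO, exists_comm]
  refine exists_congr fun k => ?_
  constructor
  · rintro ⟨m, hm⟩
    rw [getElem?_oraclePrefix] at hm
    split_ifs at hm with h
    simpa using hm
  · intro hk
    refine ⟨Nat.pair (encode (f l)) k + 1, ?_⟩
    rw [getElem?_oraclePrefix, if_pos (Nat.lt_succ_self _)]
    simpa using hk

/-- These indices will make up the complement of the effectively closed set for which `q` is
minimal. Enumerability is the reason for working with formal relations. -/
theorem rePred_refinements {R : BallCode × List Bool → Prop} (hR : REPred R) (σ : List Bool) :
    REPred fun i : List BallCode × List BallCode => ∃ x : BallCode × List Bool,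
      R (x.1, σ ++ x.2) ∧ (∀ b ∈ i.1, FormallyDisjoint x.1 b) ∧
        ∀ j ∈ declared (σ ++ x.2), FormallyRefines i j := by
  let T := (List BallCode × List BallCode) × BallCode × List Bool
  refine REPred.exists (p := fun y : T => R (y.2.1, σ ++ y.2.2) ∧
    (∀ b ∈ y.1.1, FormallyDisjoint y.2.1 b) ∧
      ∀ j ∈ declared (σ ++ y.2.2), FormallyRefines y.1 j) ?_
  have hb : Primrec fun y : T => y.2.1 := Primrec.fst.comp Primrec.snd
  have hτ : Primrec fun y : T => σ ++ y.2.2 :=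
    Primrec.list_append.comp (Primrec.const σ) (Primrec.snd.comp Primrec.snd)
  refine (hR.comp (hb.pair hτ).to_comp).and (PrimrecPred.rePred (PrimrecPred.and ?_ ?_))
  · exact primrecRel_formallyDisjoint.swap.forall_mem_list.comp
      (Primrec.fst.comp Primrec.fst) hb
  · exact primrecRel_formallyRefines.swap.forall_mem_list.comp
      (primrec_declared.comp hτ) Primrec.fst

theorem StrongComputableType.exists_isMinimalFor {X : Type*} [TopologicalSpace X] {A : Set X}
    (h : StrongComputableType A) {q : Compacts HilbertCube × Compacts HilbertCube}
    (hq : IsCopy A q) : ∃ n, IsMinimalFor (universalPi01 n) q := by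
  -- The `j`-th requirement concerns the strings at which the `j`-th program wrongly accepts a ball
  -- that misses `q.1`.
  obtain ⟨O, hO, hgen⟩ := exists_generic_oracle (neighbourhoodCodes q) fun j =>
    {τ | ∃ b, ¬((q.1 : Set HilbertCube) ∩ ratBall b).Nonempty ∧
      ((ofNat Code j).eval (encode (b, τ))).Dom}
  have hadm : ∀ m, Admissible (neighbourhoodCodes q) (oraclePrefix O m) := by
    intro m n hn
    rw [getElem?_oraclePrefix] at hn
    split_ifs at hn
    exact (hO _).2 ⟨n.unpair.2, by simpa using hn⟩
  have hov : OvertIn O q.1 := by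
    refine (h O q hq ?_ ?_).2
    · exact semicomputableIn_of_enumerates hO (f := fun l => (l, fullCover))
        (Primrec.id.pair (Primrec.const _)) (by simp [upVietorisSqBasis, ratUnion_fullCover])
    · exact semicomputableIn_of_enumerates hO (f := fun l => (fullCover, l))
        ((Primrec.const _).pair Primrec.id) (by simp [upVietorisSqBasis, ratUnion_fullCover])
  obtain ⟨R, hR, hmono, hmeet⟩ := REPredIn.exists_rePred hov
  obtain ⟨c, hc⟩ := rePred_iff_exists_code.1 hR
  obtain ⟨m₀, hm₀⟩ := hgen (encode c)
  simp only [Decides, Set.mem_ofPred_eq, ofNat_encode, ← hc, not_exists, not_and] at hm₀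
  have hsound : ∀ τ, Admissible (neighbourhoodCodes q) τ → oraclePrefix O m₀ <+: τ →
      ∀ b, R (b, τ) → ((q.1 : Set HilbertCube) ∩ ratBall b).Nonempty := by
    rcases hm₀ with ⟨b, hb, hRb⟩ | hm₀
    -- A prefix of `O` cannot be such a string, as `R` is correct along `O`; hence genericity rules
    -- out all admissible extensions.
    · exact absurd ((hmeet b).2 ⟨m₀, hRb⟩) hb
    · intro τ h₁ h₂ b hb
      by_contra hne
      exact hm₀ τ h₁ h₂ b hne hb
  obtain ⟨n, hn⟩ := exists_universalPi01_eq (rePred_refinements hR (oraclePrefix O m₀))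
  refine ⟨n, ?_⟩
  rw [hn]
  constructor
  · rintro i ⟨⟨b, ρ⟩, hRb, hdisj, href⟩ hqi
    -- Every declared set contains the basic set `i`, hence `q`, so soundness applies to this
    -- string.
    have hτ : Admissible (neighbourhoodCodes q) (oraclePrefix O m₀ ++ ρ) := by
      intro k hk
      cases hj : decode (α := List BallCode × List BallCode) k.unpair.1 with
      | none => simp at hj
      | some j => exact ⟨j, hj, (href j (mem_declared.2 ⟨k, hk, hj⟩)).subset hqi⟩
    obtain ⟨x, hx, hxb⟩ := hsound _ hτ (List.prefix_append _ _) b hRb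
    obtain ⟨b', hb', hxb'⟩ := hqi.1 hx
    exact (hdisj b' hb').not_mem hxb hxb'
  · rintro q' ⟨-, hss, hsub⟩ hq'
    obtain ⟨y, hy, hy'⟩ := Set.exists_of_ssubset hss
    obtain ⟨b, hyb, hb⟩ := exists_ratBall_away q'.1.isCompact hy'
    obtain ⟨m, hm⟩ := (hmeet b).1 ⟨y, hy, hyb⟩
    -- A longer prefix of `O` extends the forcing prefix and, by monotonicity, still accepts `b`.
    obtain ⟨ρ, hρ⟩ := oraclePrefix_prefix O (le_max_left m₀ m)
    have hRb : R (b, oraclePrefix O m₀ ++ ρ) := by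
      rw [hρ]
      exact hmono _ _ _ (oraclePrefix_prefix O (le_max_right m₀ m)) hm
    have hL : ∀ j ∈ declared (oraclePrefix O m₀ ++ ρ), q' ∈ upVietorisSqBasis j := by
      intro j hj
      rw [hρ] at hj
      have hqj := (hadm _).mem_upVietorisSqBasis j hj
      -- Upper Vietoris neighbourhoods of `q` contain all its subpairs.
      exact ⟨hss.subset.trans hqj.1, hsub.trans hqj.2⟩
    obtain ⟨i, hi, href, hdisj⟩ := exists_formallyRefines hL hb
    exact hq' i ⟨(b, ρ), hRb, hdisj, href⟩ hi

end Main

end SCT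

theorem mainTheorem3 {X : Type*} [TopologicalSpace X] [CompactSpace X]
    [TopologicalSpace.MetrizableSpace X] (A : Set X) (hA : IsCompact A) :
    SCT.StrongComputableType A ↔
      ∃ P : ℕ → Set (TopologicalSpace.Compacts SCT.HilbertCube ×
          TopologicalSpace.Compacts SCT.HilbertCube),
        SCT.UniformlyPi01 SCT.upVietorisSqBasis P ∧
        SCT.IsSigma02 SCT.upVietorisSqBasis (⋃ n, P n) ∧
        SCT.IsInvariant (⋃ n, P n) ∧
        ∀ q, SCT.IsCopy A q → ∃ n, SCT.IsMinimalFor (P n) q := by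
  constructor
  · intro h
    refine ⟨SCT.universalPi01, SCT.uniformlyPi01_universalPi01,
      SCT.uniformlyPi01_universalPi01.isSigma02_iUnion, ?_, fun q hq => h.exists_isMinimalFor hq⟩
    rw [SCT.iUnion_universalPi01]
    exact fun _ _ _ _ _ => Set.mem_univ _
  · rintro ⟨P, hP, -, -, hmin⟩ O q hq h₁ h₂
    obtain ⟨n, hn⟩ := hmin q hq
    exact hP.computableCompactIn hq.isPair hn h₁ h₂
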